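/- Let $\phi:\mathbb R\to\mathbb R$ be a smooth ($C^\infty$) activation function, normalized so that $\mathbb E_{z\sim\mathcal N(0,1)}[\phi(z)^2]=1$. Its local Q and C maps are $$\mathcal Q(q)=\mathbb E_{z\sim\mathcal N(0,q)}[\phi(z)^2],\qquad \mathcal C(c,q_1,q_2)=\frac{\mathbb E_{(z_1,z_2)\sim\mathcal N(0,\Sigma)}[\phi(z_1)\phi(z_2)]}{\sqrt{\mathcal Q(q_1)\mathcal Q(q_2)}},\qquad \Sigma=\begin{pmatrix}q_1&\sqrt{q_1q_2}\,c\\ \sqrt{q_1q_2}\,c&q_2\end{pmatrix}.$$ Let $f$ be a network with one input and one output, built from affine layers, elementwise applications of $\phi$, and normalized weighted sums (with real weights $w_1,\dots,w_n$, $\sum_i w_i^2=1$) of outputs of layers. Its global C map $\mathcal C_f:[-1,1]\to[-1,1]$ sends $c$ to the c value of the output layer when the input layer has q value $1$ and c value $c$, where q and c values propagate by the following rules: an affine layer keeps $(q,c)$; an activation layer maps $(q,c)$ to $(\mathcal Q(q),\mathcal C(c,q,q))$; a normalized sum of layers with values $(q_i,c_i)$ has the q value $q=\sum_i w_i^2q_i$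 and the c value $\frac1q\sum_i w_i^2q_ic_i$. Theorem. Suppose that $\mathcal C_f'(1)=1$ (left derivative at $1$). Then $\mathcal C_f$ is continuously differentiable on $[-1,1]$ (one-sidedly at the end points), the second derivative $\mathcal C_f''(1)=\lim_{c\to1^-}\frac{\mathcal C_f'(c)-\mathcal C_f'(1)}{c-1}$ exists as an extended real number (possibly $+\infty$), and $$\max_{c\in[-1,1]}|\mathcal C_f(c)-c|\le 2\,\mathcal C_f''(1),\qquad \max_{c\in[-1,1]}|\mathcal C_f'(c)-1|\le 2\,\mathcal C_f''(1).$$ -/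

import Mathlib

open MeasureTheory ProbabilityTheory Set Filter Topology
open scoped ContDiff

noncomputable section

namespace CMap

/-- The local Q map of an activation function `φ`:
`Q(q) = E_{z ∼ N(0, q)} [φ(z)²]`, for `q ≥ 0`. -/
def localQ (φ : ℝ → ℝ) (q : ℝ) : ℝ :=
  ∫ z, φ z ^ 2 ∂(gaussianReal 0 q.toNNReal)

/-- The matrix `Σ` with diagonal entries `q₁, q₂` and off-diagonal entry `√(q₁ q₂) c`. -/
def kernelMatrix (c q₁ q₂ : ℝ) : Matrix (Fin 2) (Fin 2) ℝ :=
  !![q₁, Real.sqrt (q₁ * q₂) * c; Real.sqrt (q₁ * q₂) * c, q₂]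

/-- The local C map of an activation function `φ`:
`C(c, q₁, q₂) = E_{(z₁, z₂) ∼ N(0, Σ)} [φ(z₁) φ(z₂)] / √(Q(q₁) Q(q₂))`,
for `c ∈ [-1, 1]` and `q₁, q₂ ≥ 0`. -/
def localC (φ : ℝ → ℝ) (c q₁ q₂ : ℝ) : ℝ :=
  (∫ z, φ (z 0) * φ (z 1) ∂(multivariateGaussian 0 (kernelMatrix c q₁ q₂))) /
    Real.sqrt (localQ φ q₁ * localQ φ q₂)

/-- The topology of a network (with one input, one output, and the same activation function in
all its nonlinear layers), described by how its output is computed. Widths play no role for Q and C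
maps. A combined layer is `activation (affine g)`. A layer whose output is used
several times is written out at each use; this changes neither its q value nor its c value. -/
inductive Network : Type
  /-- The input layer. -/
  | input : Network
  /-- An affine layer, with weights of variance `1 / fan-in` and zero biases, on top of `g`. -/
  | affine (g : Network) : Network
  /-- The elementwise activation function applied to the output of `g`. -/
  | activation (g : Network) : Network
  /-- The normalized sum, with weights `w i`, of the outputs of the `g i`. -/
  | normalizedSum (n : ℕ) (w : Fin n → ℝ) (hw : ∑ i, w i ^ 2 = 1) (g : Fin n → Network) : Network

/-- The q value at the output of a network with activation function `φ`, as a function of the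
q value `q` of the input. -/
def Network.qValue (φ : ℝ → ℝ) (q : ℝ) : Network → ℝ
  | .input => q
  | .affine g => g.qValue φ q
  | .activation g => localQ φ (g.qValue φ q)
  | .normalizedSum _ w _ g => ∑ i, w i ^ 2 * (g i).qValue φ q

/-- The c value at the output of a network with activation function `φ`, for a pair of inputs
which both have the q value `q`, as a function of the c value `c` of that pair. -/
def Network.cValue (φ : ℝ → ℝ) (q c : ℝ) : Network → ℝ
  | .input => c
  | .affine g => g.cValue φ q c
  | .activation g => localC φ (g.cValue φ q c) (g.qValue φ q) (g.qValue φ q)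
  | .normalizedSum _ w _ g =>
      (∑ i, w i ^ 2 * (g i).qValue φ q * (g i).cValue φ q c) / ∑ i, w i ^ 2 * (g i).qValue φ q

/-- The global C map `C_f` of a network `f` with activation function `φ` (inputs have
q value `1`). It is meaningful on `[-1, 1]`. -/
def globalC (φ : ℝ → ℝ) (f : Network) (c : ℝ) : ℝ :=
  f.cValue φ 1 c

/-- The derivative `C_f'` of the global C map on `[-1, 1]` (one-sided at the end points). -/
def globalCDeriv (φ : ℝ → ℝ) (f : Network) (c : ℝ) : ℝ :=
  derivWithin (globalC φ f) (Icc (-1) 1) c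

/-- `C_f''(1) = τ`: the (left) difference quotients of `C_f'` at `1` tend to `τ`, where the
value `τ = ∞` is allowed. -/
def HasSecondDerivAtOne (φ : ℝ → ℝ) (f : Network) (τ : EReal) : Prop :=
  Tendsto
    (fun c : ℝ => (((globalCDeriv φ f c - globalCDeriv φ f 1) / (c - 1) : ℝ) : EReal))
    (𝓝[<] 1) (𝓝 τ)

end CMap

end

noncomputable section

namespace CMap

open scoped RealInnerProductSpace ENNReal

/-! ### Exponentials are total in the `L²` space of the standard Gaussian -/

/-! The map `C_f` is a probability generating function: `C_f(c) = ∑ b n * c ^ n` on `[-1, 1]` with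
`b n ≥ 0` and `∑ b n = 1`. For one activation this is Mehler's formula
(`exists_hasSum_integral_mul`): `b n` is the squared Hermite coefficient of `φ`. All q values stay
`1`, and such functions are closed under composition and convex combination, so induction on the
network applies (`exists_isPGF_globalC`).

Nonnegative coefficients do the rest. A finite left derivative at `1` forces `∑ n * b n < ∞`, so
`C_f` is C¹ up to both end points. Its derivative again has nonnegative coefficients `(n + 1) * b (n
+ 1)`, so the same argument gives a dichotomy: `C_f''(1)` is the sum `S` of `n * (n + 1) * b (n +
1)`, or it is `+∞` and the bounds are trivial. If `S` is finite, then `C_f'(1) = 1` gives `1 - b 1 =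
∑_{n ≥ 1} (n + 1) * b (n + 1) ≤ S`, and termwise estimates bound both deviations by `2 * S`.

Mehler's formula is proved without Hermite polynomials: exponentials are total in `L²`, and both
sides are computed on them. -/

theorem memLp_exp_mul_gaussianReal (t : ℝ) :
    MemLp (fun x : ℝ => Real.exp (t * x)) 2 (gaussianReal 0 1) := by
  rw [memLp_two_iff_integrable_sq (by fun_prop)]
  refine (integrable_exp_mul_gaussianReal (2 * t)).congr (ae_of_all _ fun x => ?_)
  simp only [← Real.exp_nat_mul]
  congr 1
  push_cast
  ring

/-- The exponential `x ↦ exp (t x)` as an element of `L²` of the standard Gaussian. -/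
def expLp (t : ℝ) : Lp ℝ 2 (gaussianReal 0 1) := (memLp_exp_mul_gaussianReal t).toLp

/-- The finite measure with density `u⁺` with respect to the standard Gaussian. -/
def posMeasure (u : ℝ → ℝ) : Measure ℝ :=
  (gaussianReal 0 1).withDensity fun x => ((u x).toNNReal : ℝ≥0∞)

theorem integrable_exp_mul_posPart {u : ℝ → ℝ} (hu : Measurable u)
    (h2 : MemLp u 2 (gaussianReal 0 1)) (t : ℝ) :
    Integrable (fun x => (u x).toNNReal • Real.exp (t * x)) (gaussianReal 0 1) := by
  have h := ((memLp_exp_mul_gaussianReal t).integrable_mul h2).norm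
  refine h.mono' (by fun_prop) (ae_of_all _ fun x => ?_)
  simp only [NNReal.smul_def, smul_eq_mul, Real.coe_toNNReal', norm_mul, Pi.mul_apply]
  rw [mul_comm]
  gcongr
  simp only [Real.norm_eq_abs]
  rw [abs_of_nonneg (le_max_right _ _)]
  exact max_le (le_abs_self _) (abs_nonneg _)

theorem integrable_exp_mul_posMeasure {u : ℝ → ℝ} (hu : Measurable u)
    (h2 : MemLp u 2 (gaussianReal 0 1)) (t : ℝ) :
    Integrable (fun x => Real.exp (t * x)) (posMeasure u) := by
  rw [posMeasure, integrable_withDensity_iff_integrable_smul (by fun_prop)]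
  exact integrable_exp_mul_posPart hu h2 t

theorem isFiniteMeasure_posMeasure {u : ℝ → ℝ} (hu : Measurable u)
    (h2 : MemLp u 2 (gaussianReal 0 1)) : IsFiniteMeasure (posMeasure u) := by
  have h := integrable_exp_mul_posMeasure hu h2 0
  simp only [zero_mul, Real.exp_zero] at h
  exact (integrable_const_iff_isFiniteMeasure one_ne_zero).1 h

/-- Orthogonality to all exponentials says that the measures with densities `u⁺` and `u⁻` have the
same moment generating function. As it is finite everywhere, it determines the measure, so `u⁺ = u⁻`
almost everywhere, which forces `u = 0`. -/
theorem ae_eq_zero_of_integral_mul_exp_eq_zero {u : ℝ → ℝ} (hu : Measurable u)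
    (h2 : MemLp u 2 (gaussianReal 0 1))
    (h : ∀ t : ℝ, ∫ x, Real.exp (t * x) * u x ∂(gaussianReal 0 1) = 0) :
    u =ᵐ[gaussianReal 0 1] 0 := by
  have hn2 : MemLp (fun x => -u x) 2 (gaussianReal 0 1) := h2.neg
  have hn : Measurable fun x => -u x := by fun_prop
  have := isFiniteMeasure_posMeasure hu h2
  have := isFiniteMeasure_posMeasure hn hn2
  have hmgf : mgf id (posMeasure u) = mgf id (posMeasure fun x => -u x) := by
    ext t
    simp only [mgf, id_eq, posMeasure]
    rw [integral_withDensity_eq_integral_smul (by fun_prop),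
      integral_withDensity_eq_integral_smul (by fun_prop), ← sub_eq_zero,
      ← integral_sub (integrable_exp_mul_posPart hu h2 t) (integrable_exp_mul_posPart hn hn2 t)]
    refine Eq.trans ?_ (h t)
    refine integral_congr_ae (ae_of_all _ fun x => ?_)
    simp only [NNReal.smul_def, smul_eq_mul, Real.coe_toNNReal']
    rw [← sub_mul, mul_comm]
    congr 1
    rcases le_total 0 (u x) with h0 | h0
    · rw [max_eq_left h0, max_eq_right (by linarith), sub_zero]
    · rw [max_eq_right h0, max_eq_left (by linarith)]
      ring
  have hset : integrableExpSet id (posMeasure u) = univ := by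
    ext t
    simpa [integrableExpSet] using integrable_exp_mul_posMeasure hu h2 t
  have hzero : posMeasure u = 0 ↔ (posMeasure fun x => -u x) = 0 := by
    have h0 := congrFun hmgf 0
    simp only [mgf_zero'] at h0
    rw [← Measure.measure_univ_eq_zero, ← Measure.measure_univ_eq_zero,
      ← measureReal_eq_zero_iff, ← measureReal_eq_zero_iff, h0]
  have heq : posMeasure u = posMeasure fun x => -u x := by
    refine Measure.ext_of_complexMGF_id_eq (funext fun z => ?_)
    exact eqOn_complexMGF_of_mgf' hmgf hzero (by simp [hset])
  rw [posMeasure, posMeasure, withDensity_eq_iff_of_sigmaFinite (by fun_prop) (by fun_prop)] at heq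
  filter_upwards [heq] with x hx
  have hx' : (u x).toNNReal = (-u x).toNNReal := by exact_mod_cast hx
  rcases le_total 0 (u x) with h0 | h0
  · rw [Real.toNNReal_of_nonpos (by linarith : -u x ≤ 0), Real.toNNReal_eq_zero] at hx'
    exact le_antisymm hx' h0
  · rw [Real.toNNReal_of_nonpos h0, eq_comm, Real.toNNReal_eq_zero] at hx'
    exact le_antisymm h0 (neg_nonpos.1 hx')

theorem dense_span_expLp :
    Dense (Submodule.span ℝ (range expLp) : Set (Lp ℝ 2 (gaussianReal 0 1))) := by
  rw [Submodule.dense_iff_topologicalClosure_eq_top, Submodule.topologicalClosure_eq_top_iff,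
    Submodule.eq_bot_iff]
  intro v hv
  obtain ⟨u, hu, huv⟩ : ∃ u : ℝ → ℝ, Measurable u ∧ v =ᵐ[gaussianReal 0 1] u :=
    ⟨_, (Lp.stronglyMeasurable v).measurable, Filter.EventuallyEq.rfl⟩
  have h2 : MemLp u 2 (gaussianReal 0 1) := (memLp_congr_ae huv).1 (Lp.memLp v)
  rw [Lp.eq_zero_iff_ae_eq_zero]
  refine huv.trans (ae_eq_zero_of_integral_mul_exp_eq_zero hu h2 fun t => ?_)
  have ht := (Submodule.mem_orthogonal _ _).1 hv _ (Submodule.subset_span (mem_range_self t))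
  rw [L2.inner_def] at ht
  refine Eq.trans (integral_congr_ae ?_) ht
  filter_upwards [huv, (memLp_exp_mul_gaussianReal t).coeFn_toLp] with x h1 h3
  rw [expLp, h1, h3]
  simp [mul_comm]

/-- Two bilinear expressions on `L²` of the standard Gaussian that agree on exponentials agree. -/
theorem inner_eq_inner_of_expLp {F G : Type*} [NormedAddCommGroup F] [InnerProductSpace ℝ F]
    [NormedAddCommGroup G] [InnerProductSpace ℝ G]
    (A B : Lp ℝ 2 (gaussianReal 0 1) →L[ℝ] F) (C D : Lp ℝ 2 (gaussianReal 0 1) →L[ℝ] G)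
    (h : ∀ s t, ⟪A (expLp s), B (expLp t)⟫ = ⟪C (expLp s), D (expLp t)⟫)
    (u v : Lp ℝ 2 (gaussianReal 0 1)) : ⟪A u, B v⟫ = ⟪C u, D v⟫ := by
  -- Density is used in one argument at a time, the other being frozen.
  have h1 : ∀ s v, ⟪A (expLp s), B v⟫ = ⟪C (expLp s), D v⟫ := fun s v => by
    have := ContinuousLinearMap.ext_on dense_span_expLp
      (f := (innerSL ℝ (A (expLp s))).comp B) (g := (innerSL ℝ (C (expLp s))).comp D)
      (by rintro _ ⟨t, rfl⟩; simpa using h s t)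
    simpa using congrArg (fun L => L v) this
  have := ContinuousLinearMap.ext_on dense_span_expLp
    (f := (innerSL ℝ (B v)).comp A) (g := (innerSL ℝ (D v)).comp C)
    (by rintro _ ⟨s, rfl⟩; simpa [real_inner_comm] using h1 s v)
  simpa [real_inner_comm] using congrArg (fun L => L u) this

/-! ### The Hermite coefficients of exponentials -/

theorem memℓp_expCoeff (t : ℝ) : Memℓp
    (fun n : ℕ => Real.exp (t ^ 2 / 2) * t ^ n / √(n.factorial : ℝ)) 2 := by
  rw [memℓp_gen_iff (by norm_num)]
  refine ((Real.summable_pow_div_factorial (t ^ 2)).mul_left (Real.exp (t ^ 2 / 2) ^ 2)).congr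
    fun n => ?_
  rw [ENNReal.toReal_ofNat, Real.rpow_ofNat, Real.norm_eq_abs, sq_abs, div_pow, mul_pow,
    Real.sq_sqrt (by positivity)]
  ring

/-- The coefficients of `x ↦ exp (t x)` with respect to the normalized Hermite polynomials. -/
def expCoeff (t : ℝ) : lp (fun _ : ℕ => ℝ) 2 :=
  ⟨fun n => Real.exp (t ^ 2 / 2) * t ^ n / √(n.factorial : ℝ), memℓp_expCoeff t⟩

/-- The diagonal operator on `ℓ²` with entries `c ^ n`. -/
def powDiag (c : ℝ) (hc : |c| ≤ 1) : lp (fun _ : ℕ => ℝ) 2 →L[ℝ] lp (fun _ : ℕ => ℝ) 2 :=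
  lp.mapCLM (E := fun _ : ℕ => ℝ) (F := fun _ : ℕ => ℝ) 2
    (fun n => c ^ n • ContinuousLinearMap.id ℝ ℝ) (K := 1) zero_le_one fun n => by
      refine ContinuousLinearMap.opNorm_le_bound _ zero_le_one fun x => ?_
      simp only [_root_.smul_apply, ContinuousLinearMap.id_apply, norm_smul, norm_pow,
        Real.norm_eq_abs]
      gcongr
      exact pow_le_one₀ (abs_nonneg c) hc

theorem powDiag_apply (c : ℝ) (hc : |c| ≤ 1) (a : lp (fun _ : ℕ => ℝ) 2) (n : ℕ) :
    powDiag c hc a n = c ^ n * a n := rfl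

/-- The exponential series of `c * s * t`. The value is the joint moment generating function in
`integral_exp_add_mul`; this agreement is Mehler's formula on exponentials. -/
theorem inner_expCoeff_powDiag (c : ℝ) (hc : |c| ≤ 1) (s t : ℝ) :
    ⟪expCoeff s, powDiag c hc (expCoeff t)⟫ =
      Real.exp ((s ^ 2 + 2 * c * s * t + t ^ 2) / 2) := by
  have h := lp.hasSum_inner (𝕜 := ℝ) (expCoeff s) (powDiag c hc (expCoeff t))
  have h2 : HasSum (fun n : ℕ => (Real.exp (s ^ 2 / 2) * Real.exp (t ^ 2 / 2)) *
      ((c * s * t) ^ n / (n.factorial : ℝ)))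
      ((Real.exp (s ^ 2 / 2) * Real.exp (t ^ 2 / 2)) * Real.exp (c * s * t)) := by
    refine HasSum.mul_left _ ?_
    rw [Real.exp_eq_exp_ℝ]
    exact NormedSpace.expSeries_div_hasSum_exp (c * s * t)
  rw [h.unique (h2.congr_fun ?_), ← Real.exp_add, ← Real.exp_add]
  · congr 1
    ring
  · intro n
    have h3 : √(n.factorial : ℝ) * √(n.factorial : ℝ) = n.factorial :=
      Real.mul_self_sqrt (by positivity)
    rw [powDiag_apply]
    simp only [expCoeff, RCLike.inner_apply, conj_trivial]
    generalize √(n.factorial : ℝ) = r at h3 ⊢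
    rw [← h3]
    ring

/-! ### Correlated pairs of standard Gaussian variables -/

theorem kernelMatrix_one_one (c : ℝ) : kernelMatrix c 1 1 = !![1, c; c, 1] := by
  simp [kernelMatrix]

theorem dotProduct_kernelMatrix (c : ℝ) (x : Fin 2 → ℝ) :
    x ⬝ᵥ (kernelMatrix c 1 1).mulVec x = x 0 ^ 2 + 2 * c * x 0 * x 1 + x 1 ^ 2 := by
  simp [kernelMatrix_one_one, Matrix.mulVec, dotProduct, Fin.sum_univ_two]
  ring

theorem posSemidef_kernelMatrix {c : ℝ} (hc : |c| ≤ 1) : (kernelMatrix c 1 1).PosSemidef := by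
  refine Matrix.PosSemidef.of_dotProduct_mulVec_nonneg ?_ fun x => ?_
  · rw [kernelMatrix_one_one]
    ext i j
    fin_cases i <;> fin_cases j <;> simp [Matrix.conjTranspose]
  · simp only [star_trivial]
    rw [dotProduct_kernelMatrix]
    have h := abs_le.1 hc
    nlinarith [mul_nonneg (by linarith : 0 ≤ 1 + c) (sq_nonneg (x 0 + x 1)),
      mul_nonneg (by linarith : 0 ≤ 1 - c) (sq_nonneg (x 0 - x 1))]

theorem measurePreserving_coord {c : ℝ} (hc : |c| ≤ 1) (i : Fin 2) :
    MeasurePreserving (fun x : EuclideanSpace ℝ (Fin 2) => x i)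
      (multivariateGaussian 0 (kernelMatrix c 1 1)) (gaussianReal 0 1) := by
  have h := measurePreserving_eval_multivariateGaussian (μ := 0) (posSemidef_kernelMatrix hc)
    (i := i)
  have hi : kernelMatrix c 1 1 i i = 1 := by
    rw [kernelMatrix_one_one]
    fin_cases i <;> rfl
  simpa [hi] using h

/-- The functional `s * z 0 + t * z 1` is a centred real Gaussian whose variance is the quadratic
form of the covariance matrix. No density is needed, so `c = ±1` is covered. -/
theorem integral_exp_add_mul {c : ℝ} (hc : |c| ≤ 1) (s t : ℝ) :
    ∫ z, Real.exp (s * z 0) * Real.exp (t * z 1)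
        ∂(multivariateGaussian 0 (kernelMatrix c 1 1)) =
      Real.exp ((s ^ 2 + 2 * c * s * t + t ^ 2) / 2) := by
  set μ := multivariateGaussian 0 (kernelMatrix c 1 1)
  let x : EuclideanSpace ℝ (Fin 2) := !₂[s, t]
  have hx : ∀ z : EuclideanSpace ℝ (Fin 2), innerSL ℝ x z = s * z 0 + t * z 1 := fun z => by
    simp [x, PiLp.inner_apply, Fin.sum_univ_two, mul_comm]
  have hvar : Var[innerSL ℝ x; μ] = s ^ 2 + 2 * c * s * t + t ^ 2 := by
    have h1 := covarianceBilin_self (μ := μ) IsGaussian.memLp_two_id x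
    rw [covarianceBilin_multivariateGaussian (posSemidef_kernelMatrix hc),
      dotProduct_kernelMatrix] at h1
    exact h1.symm
  have hmean : ∫ z, innerSL ℝ x z ∂μ = 0 := by
    rw [ContinuousLinearMap.integral_comp_id_comm IsGaussian.integrable_id]
    simp [μ]
  have hmap := IsGaussian.map_eq_gaussianReal (μ := μ) (innerSL ℝ x)
  rw [hmean] at hmap
  have h := mgf_gaussianReal hmap 1
  rw [Real.coe_toNNReal _ (variance_nonneg _ _), hvar] at h
  simp only [mgf, one_mul, zero_add, one_pow, mul_one] at h
  rw [← h]
  congr 1 with z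
  rw [hx, Real.exp_add]

/-- Composition with the `i`-th coordinate, from `L²` of the standard Gaussian to `L²` of a
correlated pair. -/
def coordLp {c : ℝ} (hc : |c| ≤ 1) (i : Fin 2) : Lp ℝ 2 (gaussianReal 0 1) →L[ℝ]
    Lp ℝ 2 (multivariateGaussian 0 (kernelMatrix c 1 1)) :=
  (Lp.compMeasurePreservingₗᵢ ℝ _ (measurePreserving_coord hc i)).toContinuousLinearMap

theorem inner_coordLp_toLp {c : ℝ} (hc : |c| ≤ 1) {f g : ℝ → ℝ}
    (hf : MemLp f 2 (gaussianReal 0 1)) (hg : MemLp g 2 (gaussianReal 0 1)) :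
    ⟪coordLp hc 0 hf.toLp, coordLp hc 1 hg.toLp⟫ =
      ∫ z, f (z 0) * g (z 1) ∂(multivariateGaussian 0 (kernelMatrix c 1 1)) := by
  rw [L2.inner_def]
  refine integral_congr_ae ?_
  have h0 : coordLp hc 0 hf.toLp =ᵐ[_] _ :=
    (Lp.coeFn_compMeasurePreserving hf.toLp (measurePreserving_coord hc 0)).trans
      ((measurePreserving_coord hc 0).quasiMeasurePreserving.ae_eq hf.coeFn_toLp)
  have h1 : coordLp hc 1 hg.toLp =ᵐ[_] _ :=
    (Lp.coeFn_compMeasurePreserving hg.toLp (measurePreserving_coord hc 1)).trans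
      ((measurePreserving_coord hc 1).quasiMeasurePreserving.ae_eq hg.coeFn_toLp)
  filter_upwards [h0, h1] with z hz0 hz1
  rw [hz0, hz1]
  simp [mul_comm]

theorem inner_expLp (s t : ℝ) :
    ⟪expLp s, expLp t⟫ = Real.exp ((s ^ 2 + 2 * 1 * s * t + t ^ 2) / 2) := by
  have h := mgf_gaussianReal (p := gaussianReal 0 1) (X := id) Measure.map_id (s + t)
  have h2 : (s ^ 2 + 2 * 1 * s * t + t ^ 2) / 2 = 0 * (s + t) + ((1 : NNReal) : ℝ) * (s + t) ^ 2 / 2 := by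
    push_cast
    ring
  rw [h2, ← h, L2.inner_def, mgf]
  refine integral_congr_ae ?_
  filter_upwards [(memLp_exp_mul_gaussianReal s).coeFn_toLp,
    (memLp_exp_mul_gaussianReal t).coeFn_toLp] with x hs ht
  rw [expLp, expLp, hs, ht]
  simp only [RCLike.inner_apply, conj_trivial, id_eq]
  rw [← Real.exp_add]
  congr 1
  ring

/-! ### The Hermite transform -/

theorem inner_expCoeff (s t : ℝ) : ⟪expCoeff s, expCoeff t⟫ = ⟪expLp s, expLp t⟫ := by
  have h : powDiag 1 (by simp) (expCoeff t) = expCoeff t := by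
    ext n
    simp [powDiag_apply]
  rw [inner_expLp, ← inner_expCoeff_powDiag 1 (by simp), h]

/-- The isometry from `L²` of the standard Gaussian to `ℓ²` which takes the coefficients with
respect to the normalized Hermite polynomials. -/
def hermiteCoeff : Lp ℝ 2 (gaussianReal 0 1) →L[ℝ] lp (fun _ : ℕ => ℝ) 2 :=
  (Finsupp.linearCombination ℝ expCoeff).extendOfNorm (Finsupp.linearCombination ℝ expLp)

/-- The two families have the same Gram matrix. This is what makes the extension defining
`hermiteCoeff` legitimate. -/
theorem norm_linearCombination_expCoeff (α : ℝ →₀ ℝ) :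
    ‖Finsupp.linearCombination ℝ expCoeff α‖ = ‖Finsupp.linearCombination ℝ expLp α‖ := by
  rw [← sq_eq_sq₀ (norm_nonneg _) (norm_nonneg _), ← real_inner_self_eq_norm_sq,
    ← real_inner_self_eq_norm_sq]
  simp only [Finsupp.linearCombination_apply, Finsupp.sum, sum_inner, inner_sum,
    real_inner_smul_left, real_inner_smul_right, inner_expCoeff]

theorem hermiteCoeff_expLp (t : ℝ) : hermiteCoeff (expLp t) = expCoeff t := by
  have hd : DenseRange (Finsupp.linearCombination ℝ expLp) := by
    rw [DenseRange, ← LinearMap.coe_range, Finsupp.range_linearCombination]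
    exact dense_span_expLp
  have h := LinearMap.extendOfNorm_eq (f := Finsupp.linearCombination ℝ expCoeff) hd
    ⟨1, fun α => by rw [one_mul, norm_linearCombination_expCoeff]⟩ (Finsupp.single t 1)
  simpa [hermiteCoeff] using h

/-- Mehler's formula, in the form that the expectation of `φ(z₁) φ(z₂)` is a power series in the
correlation with nonnegative coefficients. -/
theorem exists_hasSum_integral_mul {φ : ℝ → ℝ} (hφ : MemLp φ 2 (gaussianReal 0 1)) :
    ∃ b : ℕ → ℝ, (∀ n, 0 ≤ b n) ∧ HasSum b (∫ x, φ x ^ 2 ∂(gaussianReal 0 1)) ∧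
      ∀ c : ℝ, |c| ≤ 1 → HasSum (fun n => b n * c ^ n)
        (∫ z, φ (z 0) * φ (z 1) ∂(multivariateGaussian 0 (kernelMatrix c 1 1))) := by
  set a := hermiteCoeff hφ.toLp
  refine ⟨fun n => a n ^ 2, fun n => sq_nonneg _, ?_, fun c hc => ?_⟩
  -- Parseval's identity, by comparison with the identity map.
  · have h := inner_eq_inner_of_expLp hermiteCoeff hermiteCoeff (.id ℝ _) (.id ℝ _)
      (fun s t => by simp [hermiteCoeff_expLp, inner_expCoeff]) hφ.toLp hφ.toLp
    have h2 : ∫ x, φ x ^ 2 ∂(gaussianReal 0 1) = ⟪a, a⟫ := by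
      rw [h, L2.inner_def]
      refine integral_congr_ae ?_
      filter_upwards [hφ.coeFn_toLp] with x hx
      simp [hx, sq]
    rw [h2]
    exact (lp.hasSum_inner (𝕜 := ℝ) a a).congr_fun fun n => by simp [sq]
  · have h := inner_eq_inner_of_expLp (coordLp hc 0) (coordLp hc 1) hermiteCoeff
      ((powDiag c hc).comp hermiteCoeff) (fun s t => by
        rw [ContinuousLinearMap.comp_apply, hermiteCoeff_expLp, hermiteCoeff_expLp,
          inner_expCoeff_powDiag, ← integral_exp_add_mul hc]
        exact inner_coordLp_toLp hc _ _) hφ.toLp hφ.toLp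
    rw [← inner_coordLp_toLp hc hφ hφ, h]
    refine (lp.hasSum_inner (𝕜 := ℝ) a (powDiag c hc a)).congr_fun fun n => ?_
    rw [powDiag_apply]
    simp only [RCLike.inner_apply, conj_trivial]
    ring

/-! ### Probability generating functions on `[-1, 1]` -/

/-- On `[-1, 1]`, the function `f` is the generating function of the probability distribution `b`
on `ℕ`. -/
structure IsPGF (b : ℕ → ℝ) (f : ℝ → ℝ) : Prop where
  nonneg : ∀ n, 0 ≤ b n
  hasSum_one : HasSum b 1
  hasSum : ∀ c, |c| ≤ 1 → HasSum (fun n => b n * c ^ n) (f c)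

namespace IsPGF

theorem apply_one {b : ℕ → ℝ} {f : ℝ → ℝ} (h : IsPGF b f) : f 1 = 1 :=
  (h.hasSum 1 (by simp)).unique (by simpa using h.hasSum_one)

theorem norm_coeff_mul_pow_le {b : ℕ → ℝ} {f : ℝ → ℝ} (h : IsPGF b f) {c : ℝ} (hc : |c| ≤ 1)
    (n : ℕ) : ‖b n * c ^ n‖ ≤ b n := by
  rw [norm_mul, norm_pow, Real.norm_eq_abs, Real.norm_eq_abs, abs_of_nonneg (h.nonneg n)]
  exact mul_le_of_le_one_right (h.nonneg n) (pow_le_one₀ (abs_nonneg c) hc)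

theorem summable_norm {b : ℕ → ℝ} {f : ℝ → ℝ} (h : IsPGF b f) {c : ℝ} (hc : |c| ≤ 1) :
    Summable fun n => ‖b n * c ^ n‖ :=
  Summable.of_nonneg_of_le (fun _ => norm_nonneg _) (h.norm_coeff_mul_pow_le hc)
    h.hasSum_one.summable

theorem abs_le_one {b : ℕ → ℝ} {f : ℝ → ℝ} (h : IsPGF b f) {c : ℝ} (hc : |c| ≤ 1) :
    |f c| ≤ 1 := by
  rw [← (h.hasSum c hc).tsum_eq, ← Real.norm_eq_abs]
  exact tsum_of_norm_bounded h.hasSum_one (h.norm_coeff_mul_pow_le hc)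

theorem id : IsPGF (Pi.single 1 1) fun c => c where
  nonneg n := by
    by_cases h : n = 1
    · subst h; simp
    · simp [h]
  hasSum_one := hasSum_pi_single 1 1
  hasSum c _ := by
    have h := hasSum_single (f := fun n => (Pi.single 1 1 : ℕ → ℝ) n * c ^ n) 1
      (fun n hn => by simp [hn])
    simpa using h

theorem one : IsPGF (Pi.single 0 1) fun _ => 1 where
  nonneg n := by
    by_cases h : n = 0
    · subst h; simp
    · simp [h]
  hasSum_one := hasSum_pi_single 0 1
  hasSum c _ := by
    have h := hasSum_single (f := fun n => (Pi.single 0 1 : ℕ → ℝ) n * c ^ n) 0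
      (fun n hn => by simp [hn])
    simpa using h

theorem mul {a b : ℕ → ℝ} {f g : ℝ → ℝ} (hf : IsPGF a f) (hg : IsPGF b g) :
    IsPGF (fun n => ∑ kl ∈ Finset.HasAntidiagonal.antidiagonal n, a kl.1 * b kl.2) fun c => f c * g c := by
  have key : ∀ c, |c| ≤ 1 → HasSum
      (fun n => (∑ kl ∈ Finset.HasAntidiagonal.antidiagonal n, a kl.1 * b kl.2) * c ^ n) (f c * g c) := by
    intro c hc
    have h1 := hf.summable_norm hc
    have h2 := hg.summable_norm hc
    have h := (summable_norm_sum_mul_antidiagonal_of_summable_norm h1 h2).of_norm.hasSum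
    rw [← tsum_mul_tsum_eq_tsum_sum_antidiagonal_of_summable_norm h1 h2, (hf.hasSum c hc).tsum_eq,
      (hg.hasSum c hc).tsum_eq] at h
    refine h.congr_fun fun n => ?_
    rw [Finset.sum_mul]
    refine Finset.sum_congr rfl fun kl hkl => ?_
    rw [← Finset.HasAntidiagonal.mem_antidiagonal.1 hkl, pow_add]
    ring
  exact ⟨fun n => Finset.sum_nonneg fun kl _ => mul_nonneg (hf.nonneg _) (hg.nonneg _),
    by simpa [hf.apply_one, hg.apply_one] using key 1 (by simp), key⟩

theorem exists_pow {b : ℕ → ℝ} {f : ℝ → ℝ} (hf : IsPGF b f) (n : ℕ) :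
    ∃ d, IsPGF d fun c => f c ^ n := by
  induction n with
  | zero => exact ⟨_, by simpa using one⟩
  | succ n ih =>
    obtain ⟨d, hd⟩ := ih
    exact ⟨_, by simpa only [pow_succ] using hd.mul hf⟩

/-- The joint weights `p i * d i m` are nonnegative and summable, so for `|c| ≤ 1` the double series
may be summed in either order. This serves both normalized sums and composition, where `f ∘ g` is a
mixture of the powers of `g`. -/
theorem mixture {ι : Type*} {p : ι → ℝ} (hp : ∀ i, 0 ≤ p i) (hp1 : HasSum p 1)
    {d : ι → ℕ → ℝ} {g : ι → ℝ → ℝ} (hg : ∀ i, IsPGF (d i) (g i)) {f : ℝ → ℝ}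
    (hf : ∀ c, |c| ≤ 1 → HasSum (fun i => p i * g i c) (f c)) :
    IsPGF (fun m => ∑' i, p i * d i m) f := by
  have h1 : Summable fun x : ι × ℕ => p x.1 * d x.1 x.2 := by
    have h0 : ∀ x : ι × ℕ, 0 ≤ p x.1 * d x.1 x.2 := fun x =>
      mul_nonneg (hp x.1) ((hg x.1).nonneg x.2)
    refine (summable_prod_of_nonneg h0).2
      ⟨fun i => (hg i).hasSum_one.summable.mul_left (p i), ?_⟩
    have h i : ∑' m, p i * d i m = p i := by
      rw [tsum_mul_left, (hg i).hasSum_one.tsum_eq, mul_one]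
    simpa only [h] using hp1.summable
  have hm : ∀ m, Summable fun i => p i * d i m := fun m =>
    (((Equiv.prodComm ℕ ι).summable_iff).2 h1).prod_factor m
  have key : ∀ c, |c| ≤ 1 → HasSum (fun m => (∑' i, p i * d i m) * c ^ m) (f c) := by
    intro c hc
    have h2 : Summable fun x : ι × ℕ => p x.1 * d x.1 x.2 * c ^ x.2 := by
      refine Summable.of_norm_bounded h1 fun x => ?_
      have h0 := mul_nonneg (hp x.1) ((hg x.1).nonneg x.2)
      rw [norm_mul, norm_pow, Real.norm_eq_abs, Real.norm_eq_abs, abs_of_nonneg h0]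
      exact mul_le_of_le_one_right h0 (pow_le_one₀ (abs_nonneg c) hc)
    obtain ⟨S, hS⟩ := h2
    have h3 := hS.prod_fiberwise (g := fun i => p i * g i c) fun i => by
      simpa only [mul_assoc] using ((hg i).hasSum c hc).mul_left (p i)
    rw [(hf c hc).unique h3]
    exact (((Equiv.prodComm ℕ ι).hasSum_iff).2 hS).prod_fiberwise fun m =>
      (hm m).hasSum.mul_right (c ^ m)
  have hf1 : f 1 = 1 := by
    refine (hf 1 (by simp)).unique (hp1.congr_fun fun i => ?_)
    rw [(hg i).apply_one, mul_one]
  exact ⟨fun m => tsum_nonneg fun i => mul_nonneg (hp i) ((hg i).nonneg m),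
    by simpa [hf1] using key 1 (by simp), key⟩

theorem exists_comp {a b : ℕ → ℝ} {f g : ℝ → ℝ} (hf : IsPGF a f) (hg : IsPGF b g) :
    ∃ d, IsPGF d fun c => f (g c) := by
  choose d hd using hg.exists_pow
  exact ⟨_, mixture hf.nonneg hf.hasSum_one hd fun c hc => hf.hasSum _ (hg.abs_le_one hc)⟩

end IsPGF

/-! ### The global C map is a probability generating function -/

theorem exists_isPGF_localC {φ : ℝ → ℝ} (hφ : Measurable φ) (hQ : localQ φ 1 = 1) :
    ∃ b, IsPGF b fun c => localC φ c 1 1 := by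
  have hQ' : ∫ x, φ x ^ 2 ∂(gaussianReal 0 1) = 1 := by simpa [localQ] using hQ
  have h2 : MemLp φ 2 (gaussianReal 0 1) := by
    rw [memLp_two_iff_integrable_sq hφ.aestronglyMeasurable]
    -- The normalization forces square integrability, as the integral of a non-integrable function
    -- is `0` by convention.
    by_contra h
    rw [integral_undef h] at hQ'
    exact zero_ne_one hQ'
  obtain ⟨b, hb, hb1, hbs⟩ := exists_hasSum_integral_mul h2
  refine ⟨b, hb, hQ' ▸ hb1, fun c hc => ?_⟩
  simpa [localC, hQ] using hbs c hc

/-- Hence only `localC φ · 1 1` ever occurs, and normalized sums act on c values as convex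
combinations. -/
theorem Network.qValue_eq_one {φ : ℝ → ℝ} (hQ : localQ φ 1 = 1) (f : Network) :
    f.qValue φ 1 = 1 := by
  induction f with
  | input => rfl
  | affine g ih => exact ih
  | activation g ih => rw [Network.qValue, ih, hQ]
  | normalizedSum n w hw g ih => simp [Network.qValue, ih, hw]

theorem exists_isPGF_globalC {φ : ℝ → ℝ} (hφ : Measurable φ) (hQ : localQ φ 1 = 1)
    (f : Network) : ∃ b, IsPGF b (globalC φ f) := by
  obtain ⟨a, ha⟩ := exists_isPGF_localC hφ hQ
  induction f with
  | input => exact ⟨_, IsPGF.id⟩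
  | affine g ih => exact ih
  | activation g ih =>
    obtain ⟨b, hb⟩ := ih
    obtain ⟨d, hd⟩ := ha.exists_comp hb
    refine ⟨d, ?_⟩
    convert hd using 2 with c
    simp [globalC, Network.cValue, Network.qValue_eq_one hQ]
  | normalizedSum n w hw g ih =>
    choose d hd using ih
    refine ⟨_, IsPGF.mixture (p := fun i => w i ^ 2) (fun i => sq_nonneg _)
      (hw ▸ hasSum_fintype _) hd fun c _ => ?_⟩
    have h := hasSum_fintype fun i => w i ^ 2 * globalC φ (g i) c
    convert h using 1
    simp [globalC, Network.cValue, Network.qValue_eq_one hQ, hw]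

/-! ### Derivatives of probability generating functions -/

/-- The divided difference `(y ^ n - x ^ n) / (y - x)`, as a polynomial. -/
def powSlope (n : ℕ) (x y : ℝ) : ℝ := ∑ k ∈ Finset.range n, y ^ k * x ^ (n - 1 - k)

theorem powSlope_mul (n : ℕ) (x y : ℝ) : powSlope n x y * (y - x) = y ^ n - x ^ n :=
  (Commute.all y x).geom_sum₂_mul n

theorem abs_powSlope_le (n : ℕ) {x y : ℝ} (hx : |x| ≤ 1) (hy : |y| ≤ 1) :
    |powSlope n x y| ≤ n := by
  refine (Finset.abs_sum_le_sum_abs _ _).trans ?_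
  refine (Finset.sum_le_sum (g := fun _ => (1 : ℝ)) fun k _ => ?_).trans (by simp)
  rw [abs_mul, abs_pow, abs_pow]
  exact mul_le_one₀ (pow_le_one₀ (abs_nonneg _) hy) (by positivity)
    (pow_le_one₀ (abs_nonneg _) hx)

theorem powSlope_self (n : ℕ) (x : ℝ) : powSlope n x x = n * x ^ (n - 1) := by
  rw [powSlope, Finset.sum_congr rfl (g := fun _ => x ^ (n - 1)) fun k hk => ?_]
  · simp
  · rw [← pow_add]
    congr 1
    have := Finset.mem_range.1 hk
    omega

theorem continuous_powSlope (n : ℕ) (x : ℝ) : Continuous (powSlope n x) := by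
  unfold powSlope
  fun_prop

theorem powSlope_nonneg (n : ℕ) {x y : ℝ} (hx : 0 ≤ x) (hy : 0 ≤ y) : 0 ≤ powSlope n x y :=
  Finset.sum_nonneg fun _ _ => by positivity

/-- Power series on `[-1, 1]` with nonnegative coefficients `b` such that `∑ n b n` converges may
be differentiated termwise, including at the end points. -/
theorem hasDerivWithinAt_of_summable {b : ℕ → ℝ} {f : ℝ → ℝ} (hb : ∀ n, 0 ≤ b n)
    (hf : ∀ c, |c| ≤ 1 → HasSum (fun n => b n * c ^ n) (f c))
    (hs : Summable fun n => n * b n) {x : ℝ} (hx : |x| ≤ 1) :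
    HasDerivWithinAt f (∑' n, b n * (n * x ^ (n - 1))) (Icc (-1) 1) x := by
  rw [hasDerivWithinAt_iff_tendsto_slope]
  -- The difference quotients are dominated termwise by `n * b n`, uniformly up to the end points.
  have h := tendsto_tsum_of_dominated_convergence (𝓕 := 𝓝[Icc (-1) 1 \ {x}] x)
    (f := fun y n => b n * powSlope n x y) (g := fun n => b n * powSlope n x x) hs
    (fun n => ((continuous_powSlope n x).tendsto x |>.mono_left nhdsWithin_le_nhds).const_mul _) ?_
  · simp only [powSlope_self] at h
    refine h.congr' ?_
    filter_upwards [self_mem_nhdsWithin] with y hy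
    have hyx : y - x ≠ 0 := sub_ne_zero.2 hy.2
    have h1 := ((hf y (abs_le.2 hy.1)).sub (hf x hx)).div_const (y - x)
    rw [slope_def_field, ← h1.tsum_eq]
    refine tsum_congr fun n => ?_
    rw [← mul_sub, ← powSlope_mul, mul_div_assoc, mul_div_cancel_right₀ _ hyx]
  · filter_upwards [self_mem_nhdsWithin] with y hy n
    rw [norm_mul, Real.norm_eq_abs, Real.norm_eq_abs, abs_of_nonneg (hb n), mul_comm]
    exact mul_le_mul_of_nonneg_right (abs_powSlope_le n hx (abs_le.2 hy.1)) (hb n)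

/-- If a power series on `[-1, 1]` with nonnegative coefficients `b` has difference quotients at
`1` bounded by `M` from the left, then so are the partial sums of `∑ n b n`. -/
theorem sum_le_of_frequently_slope_le {b : ℕ → ℝ} {f : ℝ → ℝ} (hb : ∀ n, 0 ≤ b n)
    (hf : ∀ c, |c| ≤ 1 → HasSum (fun n => b n * c ^ n) (f c)) {M : ℝ}
    (h : ∃ᶠ y in 𝓝[<] (1 : ℝ), slope f 1 y ≤ M) (s : Finset ℕ) : ∑ n ∈ s, n * b n ≤ M := by
  have h1 : Tendsto (fun y => ∑ n ∈ s, b n * powSlope n 1 y) (𝓝[<] 1)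
      (𝓝 (∑ n ∈ s, n * b n)) := by
    refine tendsto_finsetSum _ fun n _ => ?_
    have := ((continuous_powSlope n 1).tendsto 1 |>.mono_left
      (nhdsWithin_le_nhds (s := Iio 1))).const_mul (b n)
    simpa [powSlope_self, mul_comm] using this
  refine le_of_tendsto_of_frequently h1 ?_
  -- For `y > 0` every term of the slope series is nonnegative, so partial sums are at most the
  -- slope.
  have hev : ∀ᶠ y in 𝓝[<] (1 : ℝ), y ∈ Ioo (0 : ℝ) 1 := Ioo_mem_nhdsLT zero_lt_one
  refine (h.and_eventually hev).mono fun y ⟨hy, hy0, hy1⟩ => le_trans ?_ hy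
  have hyx : y - 1 ≠ 0 := by linarith [hy1]
  have h2 := ((hf y (abs_le.2 ⟨by linarith, hy1.le⟩)).sub (hf 1 (by simp))).div_const (y - 1)
  rw [slope_def_field]
  have h3 : HasSum (fun n => b n * powSlope n 1 y) ((f y - f 1) / (y - 1)) :=
    h2.congr_fun fun n => by
      rw [← mul_sub, ← powSlope_mul, mul_div_assoc, mul_div_cancel_right₀ _ hyx]
  exact sum_le_hasSum s (fun n _ => mul_nonneg (hb n) (powSlope_nonneg n zero_le_one hy0.le)) h3

/-- Asking for the bound only frequently makes the contrapositive say that, when the sum diverges,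
the slopes tend to `+∞`. -/
theorem summable_of_frequently_slope_le {b : ℕ → ℝ} {f : ℝ → ℝ} (hb : ∀ n, 0 ≤ b n)
    (hf : ∀ c, |c| ≤ 1 → HasSum (fun n => b n * c ^ n) (f c)) {M : ℝ}
    (h : ∃ᶠ y in 𝓝[<] (1 : ℝ), slope f 1 y ≤ M) : Summable fun n => n * b n :=
  summable_of_sum_le (fun n => mul_nonneg n.cast_nonneg (hb n))
    (sum_le_of_frequently_slope_le hb hf h)

theorem tendsto_slope_of_hasDerivWithinAt {f : ℝ → ℝ} {f' : ℝ}
    (h : HasDerivWithinAt f f' (Icc (-1) 1) 1) : Tendsto (slope f 1) (𝓝[<] 1) (𝓝 f') := by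
  rw [hasDerivWithinAt_iff_tendsto_slope, Icc_sdiff_right,
    nhdsWithin_Ico_eq_nhdsLT (by norm_num)] at h
  exact h

/-- The coefficients of the derivative of the power series with coefficients `b`. -/
def derivCoeff (b : ℕ → ℝ) (n : ℕ) : ℝ := (n + 1) * b (n + 1)

namespace IsPGF

variable {b : ℕ → ℝ} {f : ℝ → ℝ}

theorem derivCoeff_nonneg (h : IsPGF b f) (n : ℕ) : 0 ≤ derivCoeff b n :=
  mul_nonneg (by positivity) (h.nonneg _)

theorem summable_of_hasDerivWithinAt (h : IsPGF b f) {f' : ℝ}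
    (h1 : HasDerivWithinAt f f' (Icc (-1) 1) 1) : Summable fun n => n * b n :=
  summable_of_frequently_slope_le h.nonneg h.hasSum (M := f' + 1)
    ((tendsto_slope_of_hasDerivWithinAt h1).eventually
      (eventually_le_nhds (lt_add_one f'))).frequently

theorem summable_derivCoeff (h : Summable fun n => n * b n) : Summable (derivCoeff b) := by
  have := (summable_nat_add_iff 1).2 h
  exact this.congr fun n => by simp [derivCoeff]

theorem hasDerivWithinAt (h : IsPGF b f) (hs : Summable fun n => n * b n) {x : ℝ}
    (hx : |x| ≤ 1) :
    HasDerivWithinAt f (∑' n, derivCoeff b n * x ^ n) (Icc (-1) 1) x := by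
  have h1 := hasDerivWithinAt_of_summable h.nonneg h.hasSum hs hx
  convert h1 using 1
  have h2 : Summable fun n => b n * (n * x ^ (n - 1)) := by
    refine Summable.of_norm_bounded hs fun n => ?_
    rw [norm_mul, norm_mul, norm_pow, Real.norm_eq_abs, Real.norm_eq_abs, Real.norm_eq_abs,
      abs_of_nonneg (h.nonneg n), Nat.abs_cast, ← mul_assoc, mul_comm (b n)]
    exact mul_le_of_le_one_right (mul_nonneg n.cast_nonneg (h.nonneg n))
      (pow_le_one₀ (abs_nonneg x) hx)
  rw [h2.tsum_eq_zero_add]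
  simp only [derivCoeff, Nat.cast_zero, zero_mul, mul_zero, zero_add, Nat.add_sub_cancel]
  refine tsum_congr fun n => ?_
  push_cast
  ring

theorem hasSum_derivCoeff_mul_pow (h : IsPGF b f) (hs : Summable fun n => n * b n) (x : ℝ)
    (hx : |x| ≤ 1) : HasSum (fun n => derivCoeff b n * x ^ n) (∑' n, derivCoeff b n * x ^ n) := by
  refine (Summable.of_norm_bounded (summable_derivCoeff hs) fun n => ?_).hasSum
  rw [norm_mul, norm_pow, Real.norm_eq_abs, Real.norm_eq_abs,
    abs_of_nonneg (h.derivCoeff_nonneg n)]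
  exact mul_le_of_le_one_right (h.derivCoeff_nonneg n) (pow_le_one₀ (abs_nonneg x) hx)

theorem derivWithin_eq (h : IsPGF b f) (hs : Summable fun n => n * b n) {x : ℝ}
    (hx : x ∈ Icc (-1 : ℝ) 1) :
    derivWithin f (Icc (-1) 1) x = ∑' n, derivCoeff b n * x ^ n :=
  (h.hasDerivWithinAt hs (abs_le.2 hx)).derivWithin (uniqueDiffOn_Icc (by norm_num) x hx)

theorem contDiffOn_one (h : IsPGF b f) (hs : Summable fun n => n * b n) :
    ContDiffOn ℝ 1 f (Icc (-1) 1) := by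
  rw [contDiffOn_one_iff_derivWithin (uniqueDiffOn_Icc (by norm_num))]
  refine ⟨fun x hx => (h.hasDerivWithinAt hs (abs_le.2 hx)).differentiableWithinAt, ?_⟩
  refine ContinuousOn.congr ?_ fun x hx => h.derivWithin_eq hs hx
  refine continuousOn_tsum (fun n => by fun_prop) (summable_derivCoeff hs) fun n x hx => ?_
  rw [norm_mul, norm_pow, Real.norm_eq_abs, Real.norm_eq_abs,
    abs_of_nonneg (h.derivCoeff_nonneg n)]
  exact mul_le_of_le_one_right (h.derivCoeff_nonneg n)
    (pow_le_one₀ (abs_nonneg x) (abs_le.2 hx))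

theorem hasSum_derivCoeff (h : IsPGF b f) {f' : ℝ}
    (h1 : HasDerivWithinAt f f' (Icc (-1) 1) 1) : HasSum (derivCoeff b) f' := by
  have hs := h.summable_of_hasDerivWithinAt h1
  have h2 := h.hasSum_derivCoeff_mul_pow hs 1 (by simp)
  rw [← h.derivWithin_eq hs (by norm_num), h1.derivWithin
    (uniqueDiffOn_Icc (by norm_num) 1 (by norm_num))] at h2
  simpa using h2

/-- Termwise, `|x ^ n - 1| ≤ 2 ≤ 2 * n` for `n ≥ 1`, and the term `n = 0` vanishes. -/
theorem abs_deriv_sub_le (h : IsPGF b f) {f' : ℝ} (h1 : HasDerivWithinAt f f' (Icc (-1) 1) 1)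
    (hs2 : Summable fun n => n * derivCoeff b n) {x : ℝ} (hx : x ∈ Icc (-1 : ℝ) 1) :
    |derivWithin f (Icc (-1) 1) x - f'| ≤ 2 * ∑' n, n * derivCoeff b n := by
  have hs := h.summable_of_hasDerivWithinAt h1
  have hx' := abs_le.2 hx
  have h2 := (h.hasSum_derivCoeff_mul_pow hs x hx').sub (h.hasSum_derivCoeff h1)
  rw [h.derivWithin_eq hs hx, ← h2.tsum_eq, ← Real.norm_eq_abs]
  refine tsum_of_norm_bounded (hs2.hasSum.mul_left 2) fun n => ?_
  rw [← mul_sub_one, norm_mul, Real.norm_eq_abs, Real.norm_eq_abs,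
    abs_of_nonneg (h.derivCoeff_nonneg n)]
  have h0 := h.derivCoeff_nonneg n
  rcases n.eq_zero_or_pos with rfl | hn
  · simp
  · have h3 : |x ^ n - 1| ≤ 2 := by
      have := abs_sub (x ^ n) 1
      rw [abs_pow, abs_one] at this
      linarith [pow_le_one₀ (n := n) (abs_nonneg x) hx']
    have h4 : (1 : ℝ) ≤ n := by exact_mod_cast hn
    nlinarith [mul_le_mul_of_nonneg_left h3 h0, mul_le_mul_of_nonneg_right h4 h0]

/-- In `f c - c = ∑ b n * (c ^ n - c)` the term `n = 1` vanishes and the others are at most `2 * b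
n`, so the total is at most `2 * (1 - b 1)`. -/
theorem abs_apply_sub_le (h : IsPGF b f) (h1 : HasDerivWithinAt f 1 (Icc (-1) 1) 1)
    (hs2 : Summable fun n => n * derivCoeff b n) {c : ℝ} (hc : |c| ≤ 1) :
    |f c - c| ≤ 2 * ∑' n, n * derivCoeff b n := by
  have hb1 : 1 - b 1 ≤ ∑' n, n * derivCoeff b n := by
    -- The added point mass makes up for the term `n = 0`, which the factor `n` kills; `derivCoeff b
    -- 0` is `b 1`.
    have h2 := hasSum_le (fun n => ?_) (h.hasSum_derivCoeff h1)
      ((hasSum_pi_single 0 (derivCoeff b 0)).add hs2.hasSum)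
    · simp only [derivCoeff] at h2 ⊢
      norm_num at h2 ⊢
      linarith
    · have h0 := h.derivCoeff_nonneg n
      rcases n.eq_zero_or_pos with rfl | hn
      · simp
      · have h4 : (1 : ℝ) ≤ n := by exact_mod_cast hn
        simpa [hn.ne'] using le_mul_of_one_le_left h0 h4
  refine le_trans ?_ (mul_le_mul_of_nonneg_left hb1 zero_le_two)
  have h2 := (h.hasSum c hc).sub (h.hasSum_one.mul_right c)
  rw [one_mul] at h2
  rw [← h2.tsum_eq, ← Real.norm_eq_abs]
  refine tsum_of_norm_bounded ((h.hasSum_one.sub (hasSum_pi_single 1 (b 1))).mul_left 2)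
    fun n => ?_
  have h0 := h.nonneg n
  rw [← mul_sub, norm_mul, Real.norm_eq_abs, Real.norm_eq_abs, abs_of_nonneg h0]
  by_cases hn : n = 1
  · subst hn
    simp
  · have h3 : |c ^ n - c| ≤ 2 := by
      have := abs_sub (c ^ n) c
      rw [abs_pow] at this
      linarith [pow_le_one₀ (n := n) (abs_nonneg c) hc]
    rw [Pi.single_eq_of_ne hn]
    linarith [mul_le_mul_of_nonneg_left h3 h0]

end IsPGF

end CMap

end

theorem mainTheorem4 (φ : ℝ → ℝ) (hφ : ContDiff ℝ ∞ φ) (hQ : CMap.localQ φ 1 = 1)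
    (f : CMap.Network)
    (hC : HasDerivWithinAt (CMap.globalC φ f) 1 (Icc (-1) 1) 1) :
    ContDiffOn ℝ 1 (CMap.globalC φ f) (Icc (-1) 1) ∧
    ∃ τ : EReal, CMap.HasSecondDerivAtOne φ f τ ∧
      (∀ c ∈ Icc (-1 : ℝ) 1, ((|CMap.globalC φ f c - c| : ℝ) : EReal) ≤ 2 * τ) ∧
      (∀ c ∈ Icc (-1 : ℝ) 1, ((|CMap.globalCDeriv φ f c - 1| : ℝ) : EReal) ≤ 2 * τ) := by
  obtain ⟨b, hb⟩ := CMap.exists_isPGF_globalC hφ.continuous.measurable hQ f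
  have hs := hb.summable_of_hasDerivWithinAt hC
  refine ⟨hb.contDiffOn_one hs, ?_⟩
  -- The slope lemmas need nonnegative coefficients but not total mass `1`, so they apply again to
  -- the series of `C_f'`.
  have hslope : (fun c : ℝ => (CMap.globalCDeriv φ f c - CMap.globalCDeriv φ f 1) / (c - 1))
      =ᶠ[𝓝[<] 1] slope (fun x => ∑' n, CMap.derivCoeff b n * x ^ n) 1 := by
    have hev : ∀ᶠ y in 𝓝[<] (1 : ℝ), y ∈ Ioo (0 : ℝ) 1 := Ioo_mem_nhdsLT zero_lt_one
    filter_upwards [hev] with y hy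
    rw [slope_def_field, CMap.globalCDeriv, CMap.globalCDeriv,
      hb.derivWithin_eq hs ⟨by linarith [hy.1], hy.2.le⟩, hb.derivWithin_eq hs (by norm_num)]
  by_cases hs2 : Summable fun n => n * CMap.derivCoeff b n
  · have htwo : ∀ x : ℝ, (2 : EReal) * (x : EReal) = ((2 * x : ℝ) : EReal) := fun _ => rfl
    refine ⟨((∑' n, n * CMap.derivCoeff b n : ℝ) : EReal), ?_, fun c hc => ?_, fun c hc => ?_⟩
    · have h := CMap.tendsto_slope_of_hasDerivWithinAt (CMap.hasDerivWithinAt_of_summable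
        hb.derivCoeff_nonneg (hb.hasSum_derivCoeff_mul_pow hs) hs2 (x := 1) (by simp))
      have h2 : ∀ n : ℕ, CMap.derivCoeff b n * (n * (1 : ℝ) ^ (n - 1)) = n * CMap.derivCoeff b n :=
        fun n => by rw [one_pow, mul_one, mul_comm]
      rw [tsum_congr h2] at h
      exact (continuous_coe_real_ereal.tendsto _).comp (h.congr' hslope.symm)
    · rw [htwo, EReal.coe_le_coe_iff]
      exact hb.abs_apply_sub_le hC hs2 (abs_le.2 hc)
    · rw [htwo, EReal.coe_le_coe_iff]
      exact hb.abs_deriv_sub_le hC hs2 hc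
  · have htop : (2 : EReal) * ⊤ = ⊤ := EReal.mul_top_of_pos (by norm_num)
    refine ⟨⊤, ?_, fun c _ => by simp [htop], fun c _ => by simp [htop]⟩
    rw [CMap.HasSecondDerivAtOne, EReal.tendsto_coe_nhds_top_iff]
    refine Tendsto.congr' hslope.symm (tendsto_atTop.2 fun M => ?_)
    -- If the slopes are not eventually at least `M`, they are frequently below it, which would make
    -- the series converge.
    by_contra hM
    exact hs2 (CMap.summable_of_frequently_slope_le hb.derivCoeff_nonneg
      (hb.hasSum_derivCoeff_mul_pow hs) ((not_eventually.1 hM).mono fun y hy => (not_le.1 hy).le))
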